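/- For $(x_1,x_2)\in\mathbb{R}^2$ let $M(x_1,x_2)=\max\{|x_1|,|x_2|\}$. On the square $B=[-\pi/2,\pi/2]^2$ define $$h(x_1,x_2)=\left(\frac{x_1\sin M(x_1,x_2)}{\sqrt{x_1^2+x_2^2}},\ \frac{x_2\sin M(x_1,x_2)}{\sqrt{x_1^2+x_2^2}},\ \cos M(x_1,x_2)\right),\qquad h(0,0)=(0,0,1),$$ and extend $h$ to $\mathbb{R}^2\to S^2$ by successive reflections: each reflection in a side of a square of the grid $B+\pi\mathbb{Z}^2$ in the domain corresponds to the reflection in the plane $\{x_3=0\}$ in the range. The Zorich map is $\mathcal{Z}:\mathbb{R}^3\to\mathbb{R}^3\setminus\{0\}$, $\mathcal{Z}(x_1,x_2,x_3)=e^{x_3}h(x_1,x_2)$. Fix $P\in\mathbb{R}^3$ and let $$Y=\{P+(x_1,x_2,x_3): M(x_1,x_2)=1,\ x_3>0,\ x_1x_2(x_1^2-x_2^2)\neq 0\},$$ a subset of the boundary of a semi-infinite square beam. For $\alpha\in Y$ let $L_\alpha$ be the line through $P$ and $\alpha$. Let $U=B(q,\delta)$ be an open ball in $\mathbb{R}^3$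 with $|q|\neq 1$ and $0<\delta<|q|$, and let $$X_U=\{\alpha\in Y: (\mathcal{Z}\circ\mathcal{Z})(L_\alpha)\cap U\neq\emptyset\}.$$ Then there is $\epsilon>0$ such that every $\alpha\in Y$ is an $\epsilon$-density point of $X_U$ with respect to surface area $m$ on $Y$; that is, $X_U$ is $m$-measurable and, for every $\alpha\in Y$, the limit $$\lim_{r\to 0^+}\frac{m(X_U\cap B(\alpha,r))}{m(Y\cap B(\alpha,r))}$$ exists and is at least $\epsilon$. -/

import Mathlib

open MeasureTheory Set Filter Topology
open scoped ENNReal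

/-- Euclidean three-space. -/
abbrev E3 : Type := EuclideanSpace ℝ (Fin 3)

/-- The maximum `M(x₁, x₂) = max {|x₁|, |x₂|}`. -/
noncomputable def maxAbs (x₁ x₂ : ℝ) : ℝ := max |x₁| |x₂|

/-- The map `h` on the square `B = [-π/2, π/2]²`, onto the closed upper unit hemisphere:
`h(x₁, x₂) = (x₁ sin M / √(x₁² + x₂²), x₂ sin M / √(x₁² + x₂²), cos M)`.
At the origin, division by zero gives `(0, 0, 1)`, which is the continuous extension. -/
noncomputable def hSquare (x₁ x₂ : ℝ) : E3 :=
  !₂[x₁ * Real.sin (maxAbs x₁ x₂) / √(x₁ ^ 2 + x₂ ^ 2),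
     x₂ * Real.sin (maxAbs x₁ x₂) / √(x₁ ^ 2 + x₂ ^ 2),
     Real.cos (maxAbs x₁ x₂)]

/-- The index `j` of an interval `[jπ - π/2, jπ + π/2]` that contains `x`. -/
noncomputable def stripIndex (x : ℝ) : ℤ := round (x / Real.pi)

/-- Folding of the real line onto `[-π/2, π/2]` by successive reflections in the points
`π/2 + jπ`; on `[jπ - π/2, jπ + π/2]` it is `x ↦ (-1)^j (x - jπ)`. -/
noncomputable def foldLine (x : ℝ) : ℝ :=
  (-1) ^ stripIndex x * (x - stripIndex x * Real.pi)

/-- Reflection in the equatorial plane `{x₃ = 0}`, applied `n` times. -/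
noncomputable def equatorFlip (n : ℤ) (y : E3) : E3 := !₂[y 0, y 1, (-1) ^ n * y 2]

/-- The extension of `h` to the plane: each reflection in a side of a square of the grid in the
domain is matched by a reflection in the equator in the range. -/
noncomputable def hPlane (x₁ x₂ : ℝ) : E3 :=
  equatorFlip (stripIndex x₁ + stripIndex x₂) (hSquare (foldLine x₁) (foldLine x₂))

/-- The Zorich map `𝒵(x₁, x₂, x₃) = exp(x₃) h(x₁, x₂)`. -/
noncomputable def zorich (x : E3) : E3 := Real.exp (x 2) • hPlane (x 0) (x 1)

/-- The parameter set `Y` of lines through `P`: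
`Y = {P + x : M(x₁, x₂) = 1, x₃ > 0, x₁ x₂ (x₁² - x₂²) ≠ 0}`. -/
def lineParam (P : E3) : Set E3 :=
  {α | ∃ x : E3, α = P + x ∧ maxAbs (x 0) (x 1) = 1 ∧ 0 < x 2 ∧
    x 0 * x 1 * ((x 0) ^ 2 - (x 1) ^ 2) ≠ 0}

/-- The set `X_U` of those `α ∈ Y` for which the image under `𝒵 ∘ 𝒵` of the line `L_α` through
`P` and `α` meets `U`. -/
def hitSet (P : E3) (U : Set E3) : Set E3 :=
  {α | α ∈ lineParam P ∧
    (((zorich ∘ zorich) '' (line[ℝ, P, α] : Set E3)) ∩ U).Nonempty}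

/-- Surface area on `Y`, that is, the two-dimensional Hausdorff measure (normalized to agree with
Lebesgue measure on planes) restricted to `Y`. -/
noncomputable def areaOn (P : E3) : Measure E3 := (μHE[2] : Measure E3).restrict (lineParam P)

/-- `x` is an `ε`-density point of the `μ`-measurable set `E`: the limit of
`μ(E ∩ B(x, r)) / μ(B(x, r))` as `r → 0⁺` exists and is at least `ε`. -/
def IsDensityPoint {X : Type*} [PseudoMetricSpace X] [MeasurableSpace X] (μ : Measure X)
    (ε : ℝ) (E : Set X) (x : X) : Prop :=
  NullMeasurableSet E μ ∧
    ∃ l : ℝ≥0∞, ENNReal.ofReal ε ≤ l ∧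
      Tendsto (fun r : ℝ => μ (E ∩ Metric.ball x r) / μ (Metric.ball x r)) (𝓝[>] 0) (𝓝 l)

/-! The set `hitSet` has full measure in Y, so every density is 1 and ε = 1 works. It suffices that
the set of missing parameters is porous at each of its points along scales tending to 0: the
Lebesgue density theorem then makes it null (`addHaar_eq_zero_of_porous`).

Holes come from expansion near the walls x₁ = kπ + π/2, which 𝒵 maps into the plane x₃ = 0. A line t
↦ P + t(1, a, b) with b > 0 crosses such a wall at a height whose exponential N tends to infinity
with k. A time shift τ of order 1/N makes the third coordinate of the image close to any prescribed
p₂, while the first two have size about N. At that time T, changing (a, b) by a multiple of 1/(NT)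
moves the point by a multiple of 1/N and its image horizontally by a bounded amount. This reaches a
translate of p by the periods 2πℤ², where p is chosen so that 𝒵 maps a ball about p into U. All (a,
b) in a ball of radius comparable to 1/(NT) then hit U, with a ratio of radii independent of k
(`ball_subset_of_crossing`, `porous_face`).

The estimates require crossings away from the grid corners. Since 0 < |a| < 1, one of any two
consecutive crossings qualifies (`exists_shift_away_from_sides`). The other faces reduce to x₁ = 1
because 𝒵 commutes with the reflections in `faceSymm`. -/

/-! ### Porous sets are null. -/

/-- A subset of a finite-dimensional space which at each of its points is porous, along some
sequence of scales, is a null set. -/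
theorem addHaar_eq_zero_of_porous {E : Type*} [NormedAddCommGroup E] [NormedSpace ℝ E]
    [FiniteDimensional ℝ E] [MeasurableSpace E] [BorelSpace E] [HasBesicovitchCovering E]
    (μ : Measure E) [μ.IsAddHaarMeasure] (s : Set E)
    (h : ∀ x ∈ s, ∃ κ : ℝ, 0 < κ ∧ ∀ ε > 0, ∃ r, 0 < r ∧ r < ε ∧ ∃ y,
      Metric.ball y (κ * r) ⊆ Metric.closedBall x r \ s) : μ s = 0 := by
  have hae := Besicovitch.ae_tendsto_measure_inter_div μ s
  have hnot : ∀ x ∈ s, ¬ Tendsto (fun r => μ (s ∩ Metric.closedBall x r) /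
      μ (Metric.closedBall x r)) (𝓝[>] 0) (𝓝 1) := by
    intro x hx hlim
    obtain ⟨κ, hκ, hr⟩ := h x hx
    set d := Module.finrank ℝ E
    -- The hole occupies the proportion κ^d of the ball, so the density of s at these scales is at
    -- most 1 - κ^d.
    set η : ℝ≥0∞ := ENNReal.ofReal (κ ^ d) with hη
    have hη0 : η ≠ 0 := by simp [hη]; positivity
    have hlt : 1 - η < 1 := ENNReal.sub_lt_self (by simp) (by simp) hη0
    have hev := hlim.eventually (lt_mem_nhds hlt)
    rw [eventually_nhdsWithin_iff, Metric.eventually_nhds_iff] at hev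
    obtain ⟨ε, hε, hev⟩ := hev
    obtain ⟨r, hr0, hrε, y, hy⟩ := hr ε hε
    have h1 := hev (y := r) (by simpa [abs_of_pos hr0] using hrε) hr0
    apply absurd h1 (not_lt.2 _)
    have hpos : μ (Metric.closedBall x r) ≠ 0 := (Metric.measure_closedBall_pos μ x hr0).ne'
    have hfin : μ (Metric.closedBall x r) ≠ ⊤ := measure_closedBall_lt_top.ne
    have hball : μ (Metric.ball y (κ * r)) = η * μ (Metric.closedBall x r) := by
      rw [Measure.addHaar_ball_mul_of_pos μ y hκ, Measure.addHaar_closedBall μ x hr0.le,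
        Measure.addHaar_ball_of_pos μ 0 hr0]
    rw [ENNReal.div_le_iff hpos hfin]
    calc μ (s ∩ Metric.closedBall x r)
        ≤ μ (Metric.closedBall x r \ Metric.ball y (κ * r)) := by
          refine measure_mono fun z hz => ⟨hz.2, fun hz' => (hy hz').2 hz.1⟩
      _ = μ (Metric.closedBall x r) - μ (Metric.ball y (κ * r)) :=
          measure_sdiff (fun z hz => (hy hz).1) measurableSet_ball.nullMeasurableSet
            measure_ball_lt_top.ne
      _ = (1 - η) * μ (Metric.closedBall x r) := by
          rw [hball, ENNReal.sub_mul (fun _ _ => hfin), one_mul]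
  by_contra hs
  have : NeZero (μ.restrict s) := ⟨by simpa using hs⟩
  -- Since s need not be measurable, membership in s is obtained only frequently, not almost
  -- everywhere, for the restricted measure.
  have h2 : ∃ᵐ x ∂μ.restrict s, x ∈ s := by
    rw [Filter.Frequently]
    intro hcon
    have h3 : μ.restrict s s = 0 := measure_mono_null (fun x hx => by simpa using hx) hcon
    simp at h3
    exact hs h3
  obtain ⟨x, hxs, hx⟩ := (h2.and_eventually hae).exists
  exact hnot x hxs hx

/-! ### Faces of the beam and surface area. -/

/-- The isometric parametrization of a face of the beam: the symmetry `S` carries the face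
`x₁ = 1` to it. -/
noncomputable def faceMap (P : E3) (S : E3 ≃ₗᵢ[ℝ] E3) (x : EuclideanSpace ℝ (Fin 2)) : E3 :=
  P + S !₂[1, x 0, x 1]

theorem isometry_faceMap (P : E3) (S : E3 ≃ₗᵢ[ℝ] E3) : Isometry (faceMap P S) := by
  refine Isometry.of_dist_eq fun x y => ?_
  rw [faceMap, faceMap, dist_add_left, S.dist_map]
  rw [EuclideanSpace.dist_eq, EuclideanSpace.dist_eq]
  simp [Fin.sum_univ_three]

/-- The parameters of the lines through a face of the beam, away from its edges and its
bisecting plane. -/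
def faceParam : Set (EuclideanSpace ℝ (Fin 2)) := {x | x 0 ≠ 0 ∧ |x 0| < 1 ∧ 0 < x 1}

theorem isOpen_faceParam : IsOpen faceParam := by
  have h0 : IsOpen {x : EuclideanSpace ℝ (Fin 2) | x 0 ≠ 0} :=
    isOpen_ne_fun (by fun_prop) (by fun_prop)
  have h1 : IsOpen {x : EuclideanSpace ℝ (Fin 2) | |x 0| < 1} :=
    isOpen_lt (by fun_prop) (by fun_prop)
  have h2 : IsOpen {x : EuclideanSpace ℝ (Fin 2) | 0 < x 1} :=
    isOpen_lt (by fun_prop) (by fun_prop)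
  exact h0.inter (h1.inter h2)

theorem volume_eq_area_faceMap (P : E3) (S : E3 ≃ₗᵢ[ℝ] E3) (s : Set (EuclideanSpace ℝ (Fin 2))) :
    (μHE[2] : Measure E3) (faceMap P S '' s) = volume s := by
  rw [(isometry_faceMap P S).euclideanHausdorffMeasure_image,
    EuclideanSpace.euclideanHausdorffMeasure_eq_volume]

/-- The reflection `x₁ ↦ -x₁`. -/
noncomputable def negFirst : E3 ≃ₗᵢ[ℝ] E3 :=
  LinearIsometryEquiv.piLpCongrRight 2
    fun i => if i = 0 then LinearIsometryEquiv.neg ℝ else LinearIsometryEquiv.refl ℝ ℝ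

/-- The reflection `(x₁, x₂) ↦ (x₂, x₁)`. -/
noncomputable def swapFirst : E3 ≃ₗᵢ[ℝ] E3 :=
  LinearIsometryEquiv.piLpCongrLeft 2 ℝ ℝ (Equiv.swap 0 1)

theorem negFirst_apply (x : E3) : negFirst x = !₂[-x 0, x 1, x 2] := by
  ext i
  fin_cases i <;> simp [negFirst]

theorem swapFirst_apply (x : E3) : swapFirst x = !₂[x 1, x 0, x 2] := by
  ext i
  fin_cases i <;> simp [swapFirst, LinearIsometryEquiv.piLpCongrLeft_apply, Equiv.piCongrLeft']
  rfl

/-- The symmetries that carry the face `x₁ = 1` of the beam to its four faces. -/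
noncomputable def faceSymm : Fin 4 → (E3 ≃ₗᵢ[ℝ] E3) :=
  ![LinearIsometryEquiv.refl ℝ E3, negFirst, swapFirst, negFirst.trans swapFirst]

theorem lineParam_eq_iUnion (P : E3) :
    lineParam P = ⋃ i, faceMap P (faceSymm i) '' faceParam := by
  ext α
  simp only [mem_iUnion, lineParam, mem_ofPred_eq, mem_image]
  constructor
  · rintro ⟨x, rfl, hM, hx2, hx⟩
    have hx0 : x 0 ≠ 0 := by rintro h; simp [h] at hx
    have hx1 : x 1 ≠ 0 := by rintro h; simp [h] at hx
    have hne : |x 0| ≠ |x 1| := fun h => hx (by rw [sq_eq_sq_iff_abs_eq_abs _ _ |>.2 h]; simp)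
    unfold maxAbs at hM
    rcases lt_or_gt_of_ne hne with hlt | hlt
    · rw [max_eq_right hlt.le] at hM
      rcases (abs_eq zero_le_one).1 hM with h1 | h1
      · refine ⟨2, !₂[x 0, x 2], ⟨by simpa, by simpa [hM] using hlt, by simpa⟩, ?_⟩
        simp only [faceMap, faceSymm]
        congr 1
        ext i; fin_cases i <;> simp [swapFirst_apply, h1]
      · refine ⟨3, !₂[x 0, x 2], ⟨by simpa, by simpa [hM] using hlt, by simpa⟩, ?_⟩
        simp only [faceMap, faceSymm]
        congr 1
        ext i; fin_cases i <;> simp [swapFirst_apply, negFirst_apply, h1]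
    · rw [max_eq_left hlt.le] at hM
      rcases (abs_eq zero_le_one).1 hM with h1 | h1
      · refine ⟨0, !₂[x 1, x 2], ⟨by simpa, by simpa [hM] using hlt, by simpa⟩, ?_⟩
        simp only [faceMap, faceSymm]
        congr 1
        ext i; fin_cases i <;> simp [h1]
      · refine ⟨1, !₂[x 1, x 2], ⟨by simpa, by simpa [hM] using hlt, by simpa⟩, ?_⟩
        simp only [faceMap, faceSymm]
        congr 1
        ext i; fin_cases i <;> simp [negFirst_apply, h1]
  · rintro ⟨i, y, ⟨h0, h1, h2⟩, rfl⟩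
    refine ⟨faceSymm i !₂[1, y 0, y 1], rfl, ?_⟩
    have h3 : 1 - y 0 ^ 2 ≠ 0 := by
      have := (sq_lt_one_iff_abs_lt_one (y 0)).2 h1
      linarith
    have h4 : y 0 ^ 2 - 1 ≠ 0 := fun h => h3 (by linarith)
    fin_cases i <;> simp [faceSymm, negFirst_apply, swapFirst_apply, maxAbs, h1.le, h2, h0, h3, h4]

theorem measurableSet_lineParam (P : E3) : MeasurableSet (lineParam P) := by
  rw [lineParam_eq_iUnion]
  exact MeasurableSet.iUnion fun i =>
    (isometry_faceMap P _).isClosedEmbedding.measurableEmbedding.measurableSet_image.2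
      isOpen_faceParam.measurableSet

theorem areaOn_ball_pos {P α : E3} (hα : α ∈ lineParam P) {r : ℝ} (hr : 0 < r) :
    areaOn P (Metric.ball α r) ≠ 0 := by
  rw [areaOn, Measure.restrict_apply measurableSet_ball]
  have hα' := hα
  rw [lineParam_eq_iUnion, mem_iUnion] at hα'
  obtain ⟨i, x, hx, rfl⟩ := hα'
  have hpos : 0 < volume (Metric.ball x r ∩ faceParam) :=
    (Metric.isOpen_ball.inter isOpen_faceParam).measure_pos _ ⟨x, Metric.mem_ball_self hr, hx⟩
  rw [← volume_eq_area_faceMap P (faceSymm i)] at hpos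
  refine (hpos.trans_le (measure_mono ?_)).ne'
  rintro _ ⟨y, ⟨hy, hy'⟩, rfl⟩
  refine ⟨?_, ?_⟩
  · rw [Metric.mem_ball, (isometry_faceMap P _).dist_eq]; exact hy
  · rw [lineParam_eq_iUnion]; exact mem_iUnion.2 ⟨i, y, hy', rfl⟩

theorem areaOn_ball_ne_top (P α : E3) (r : ℝ) : areaOn P (Metric.ball α r) ≠ ⊤ := by
  rw [areaOn, Measure.restrict_apply measurableSet_ball]
  have hsub : Metric.ball α r ∩ lineParam P ⊆
      ⋃ i, faceMap P (faceSymm i) '' (faceMap P (faceSymm i) ⁻¹' Metric.ball α r) := by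
    rintro x ⟨hx, hx'⟩
    rw [lineParam_eq_iUnion, mem_iUnion] at hx'
    obtain ⟨i, y, hy, rfl⟩ := hx'
    exact mem_iUnion.2 ⟨i, y, hx, rfl⟩
  refine ((measure_mono hsub).trans_lt ((measure_iUnion_le _).trans_lt ?_)).ne
  rw [tsum_fintype, ENNReal.sum_lt_top]
  intro i _
  rw [volume_eq_area_faceMap]
  exact ((isometry_faceMap P (faceSymm i)).antilipschitz.isBounded_preimage
    Metric.isBounded_ball).measure_lt_top

/-- Removing a null set leaves every density quotient equal to 1; null-measurability comes from the
null complement. -/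
theorem isDensityPoint_one_of_conull {P : E3} {s : Set E3}
    (hs : ∀ i, volume (faceParam \ faceMap P (faceSymm i) ⁻¹' s) = 0)
    {α : E3} (hα : α ∈ lineParam P) : IsDensityPoint (areaOn P) 1 s α := by
  have hnull : areaOn P sᶜ = 0 := by
    rw [areaOn, Measure.restrict_apply' (measurableSet_lineParam P)]
    refine measure_mono_null (t := ⋃ i, faceMap P (faceSymm i) ''
      (faceParam \ faceMap P (faceSymm i) ⁻¹' s)) ?_ ?_
    · rintro x ⟨hx, hx'⟩
      rw [lineParam_eq_iUnion, mem_iUnion] at hx'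
      obtain ⟨i, y, hy, rfl⟩ := hx'
      exact mem_iUnion.2 ⟨i, y, ⟨hy, hx⟩, rfl⟩
    · refine measure_iUnion_null fun i => ?_
      rw [volume_eq_area_faceMap]; exact hs i
  refine ⟨?_, 1, by simp, ?_⟩
  · exact NullMeasurableSet.compl_iff.1 (NullMeasurableSet.of_null hnull)
  · refine tendsto_const_nhds.congr' ?_
    filter_upwards [self_mem_nhdsWithin] with r hr
    have : areaOn P (s ∩ Metric.ball α r) = areaOn P (Metric.ball α r) := by
      rw [inter_comm]
      exact measure_inter_conull hnull
    rw [this, ENNReal.div_self (areaOn_ball_pos hα hr) (areaOn_ball_ne_top P α r)]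

/-! ### Explicit formulas and symmetries of the Zorich map. -/

theorem abs_neg_one_zpow_mul (n : ℤ) (x : ℝ) : |(-1 : ℝ) ^ n * x| = |x| := by
  rw [abs_mul, abs_zpow]; simp

theorem neg_one_zpow_sq (n : ℤ) : ((-1 : ℝ) ^ n) ^ 2 = 1 := by
  rw [← sq_abs, abs_zpow]; simp

theorem stripIndex_eq {j : ℤ} {y : ℝ} (h1 : -(Real.pi / 2) ≤ y) (h2 : y < Real.pi / 2) :
    stripIndex (j * Real.pi + y) = j := by
  have hpi := Real.pi_pos
  have hdiv : (j * Real.pi + y) / Real.pi = j + y / Real.pi := by field_simp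
  rw [stripIndex, hdiv, round_eq, Int.floor_eq_iff]
  have h3 : -(1 / 2) ≤ y / Real.pi := by rw [le_div_iff₀ hpi]; linarith
  have h4 : y / Real.pi < 1 / 2 := by rw [div_lt_iff₀ hpi]; linarith
  constructor <;> linarith

theorem stripIndex_half (j : ℤ) : stripIndex (j * Real.pi + Real.pi / 2) = j + 1 := by
  have h : (j : ℝ) * Real.pi + Real.pi / 2 = (j + 1 : ℤ) * Real.pi + -(Real.pi / 2) := by
    push_cast; ring
  rw [h]
  exact stripIndex_eq le_rfl (by linarith [Real.pi_pos])

/-- At y = π/2 rounding gives the index j + 1, but the formulas of the two neighbouring strips agree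
there, so the closed strip is allowed. -/
theorem foldLine_eq {j : ℤ} {y : ℝ} (hy : |y| ≤ Real.pi / 2) :
    foldLine (j * Real.pi + y) = (-1) ^ j * y := by
  obtain ⟨h1, h2⟩ := abs_le.1 hy
  rcases h2.lt_or_eq with h2 | rfl
  · rw [foldLine, stripIndex_eq h1 h2]; ring
  · rw [foldLine, stripIndex_half, zpow_add₀ (by norm_num)]; push_cast; ring

theorem maxAbs_neg_one_zpow (j l : ℤ) (y z : ℝ) :
    maxAbs ((-1) ^ j * y) ((-1) ^ l * z) = maxAbs y z := by
  rw [maxAbs, maxAbs, abs_neg_one_zpow_mul, abs_neg_one_zpow_mul]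

theorem hPlane_eq {j l : ℤ} {y z : ℝ} (hy : |y| ≤ Real.pi / 2) (hz : |z| ≤ Real.pi / 2) :
    hPlane (j * Real.pi + y) (l * Real.pi + z) =
      !₂[(-1) ^ j * (y * Real.sin (maxAbs y z) / √(y ^ 2 + z ^ 2)),
        (-1) ^ l * (z * Real.sin (maxAbs y z) / √(y ^ 2 + z ^ 2)),
        (-1) ^ (j + l) * Real.cos (maxAbs y z)] := by
  have hthird : (-1 : ℝ) ^ (stripIndex (j * Real.pi + y) + stripIndex (l * Real.pi + z)) *
      Real.cos (maxAbs y z) = (-1) ^ (j + l) * Real.cos (maxAbs y z) := by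
    -- The strip index is ambiguous only on the sides of the square, where the cosine vanishes and
    -- the sign is irrelevant.
    by_cases hM : maxAbs y z = Real.pi / 2
    · simp [hM]
    · have h1 : y ≠ Real.pi / 2 := by
        rintro rfl
        exact hM (by rw [maxAbs, abs_of_pos (by positivity)]; exact max_eq_left hz)
      have h2 : z ≠ Real.pi / 2 := by
        rintro rfl
        exact hM (by rw [maxAbs, abs_of_pos (a := Real.pi / 2) (by positivity)]
                     exact max_eq_right hy)
      rw [stripIndex_eq (abs_le.1 hy).1 (lt_of_le_of_ne (abs_le.1 hy).2 h1),
        stripIndex_eq (abs_le.1 hz).1 (lt_of_le_of_ne (abs_le.1 hz).2 h2)]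
  rw [hPlane, foldLine_eq hy, foldLine_eq hz, hSquare, equatorFlip, maxAbs_neg_one_zpow]
  ext i
  fin_cases i
  · simp [mul_pow, neg_one_zpow_sq]; ring
  · simp [mul_pow, neg_one_zpow_sq]; ring
  · simpa using hthird

theorem exists_strip (x : ℝ) : ∃ (j : ℤ) (y : ℝ), |y| ≤ Real.pi / 2 ∧ x = j * Real.pi + y := by
  have hpi := Real.pi_pos
  refine ⟨round (x / Real.pi), x - round (x / Real.pi) * Real.pi, ?_, by ring⟩
  have h := abs_sub_round (x / Real.pi)
  have h1 : x - round (x / Real.pi) * Real.pi = (x / Real.pi - round (x / Real.pi)) * Real.pi := by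
    field_simp
  rw [h1, abs_mul, abs_of_pos hpi]
  nlinarith

theorem hPlane_neg (x₁ x₂ : ℝ) : hPlane (-x₁) x₂ = negFirst (hPlane x₁ x₂) := by
  obtain ⟨j, y, hy, rfl⟩ := exists_strip x₁
  obtain ⟨l, z, hz, rfl⟩ := exists_strip x₂
  have h : -(j * Real.pi + y) = ((-j : ℤ) : ℝ) * Real.pi + -y := by push_cast; ring
  rw [h, hPlane_eq (by simpa using hy) hz, hPlane_eq hy hz, negFirst_apply]
  have hM : maxAbs (-y) z = maxAbs y z := by simp [maxAbs]
  rw [hM]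
  have hs : ∀ n : ℤ, (-1 : ℝ) ^ (-n) = (-1) ^ n := fun n => by
    rw [zpow_neg, ← inv_zpow]; norm_num
  have hs' : (-1 : ℝ) ^ (-j + l) = (-1) ^ (j + l) := by
    rw [zpow_add₀ (by norm_num), hs, zpow_add₀ (by norm_num)]
  ext i
  fin_cases i
  · simp [-zpow_neg, hs]; ring
  · simp
  · simp [hs']

theorem hPlane_swap (x₁ x₂ : ℝ) : hPlane x₂ x₁ = swapFirst (hPlane x₁ x₂) := by
  obtain ⟨j, y, hy, rfl⟩ := exists_strip x₁
  obtain ⟨l, z, hz, rfl⟩ := exists_strip x₂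
  rw [hPlane_eq hy hz, hPlane_eq hz hy, swapFirst_apply]
  have hM : maxAbs z y = maxAbs y z := max_comm _ _
  rw [hM, add_comm l j, add_comm (z ^ 2)]
  ext i
  fin_cases i <;> simp

/-- An even number of reflections in parallel sides amounts to a translation in the domain and the
identity in the range. -/
theorem hPlane_periodic (m n : ℤ) (x₁ x₂ : ℝ) :
    hPlane (x₁ + 2 * Real.pi * m) (x₂ + 2 * Real.pi * n) = hPlane x₁ x₂ := by
  obtain ⟨j, y, hy, rfl⟩ := exists_strip x₁
  obtain ⟨l, z, hz, rfl⟩ := exists_strip x₂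
  have h1 : (j : ℝ) * Real.pi + y + 2 * Real.pi * m = ((j + 2 * m : ℤ) : ℝ) * Real.pi + y := by
    push_cast; ring
  have h2 : (l : ℝ) * Real.pi + z + 2 * Real.pi * n = ((l + 2 * n : ℤ) : ℝ) * Real.pi + z := by
    push_cast; ring
  have hs : ∀ n : ℤ, (-1 : ℝ) ^ (2 * n) = 1 := fun n => by simp [zpow_mul]
  rw [h1, h2, hPlane_eq hy hz, hPlane_eq hy hz]
  have h3 : j + 2 * m + (l + 2 * n) = (j + l) + 2 * (m + n) := by ring
  simp only [h3, zpow_add₀ (show (-1 : ℝ) ≠ 0 by norm_num), hs, mul_one]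

theorem zorich_negFirst (x : E3) : zorich (negFirst x) = negFirst (zorich x) := by
  rw [zorich, zorich, map_smul, ← hPlane_neg]
  simp [negFirst_apply]

theorem zorich_swapFirst (x : E3) : zorich (swapFirst x) = swapFirst (zorich x) := by
  rw [zorich, zorich, map_smul, ← hPlane_swap]
  simp [swapFirst_apply]

theorem zorich_faceSymm (i : Fin 4) (x : E3) :
    zorich (faceSymm i x) = faceSymm i (zorich x) := by
  fin_cases i <;> simp [faceSymm, zorich_negFirst, zorich_swapFirst]

/-- Across the side `x₁ = kπ + π/2` of a square the Zorich map is given by one formula. -/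
theorem hPlane_edge {k l : ℤ} {τ z : ℝ} (hτ : |τ| ≤ Real.pi / 2) (hz : |z| ≤ Real.pi / 2 - |τ|) :
    hPlane (k * Real.pi + Real.pi / 2 + τ) (l * Real.pi + z) =
      !₂[(-1) ^ k * ((Real.pi / 2 - |τ|) * Real.cos τ / √((Real.pi / 2 - |τ|) ^ 2 + z ^ 2)),
        (-1) ^ l * (z * Real.cos τ / √((Real.pi / 2 - |τ|) ^ 2 + z ^ 2)),
        -((-1) ^ (k + l) * Real.sin τ)] := by
  have hz' : |z| ≤ Real.pi / 2 := hz.trans (by linarith [abs_nonneg τ])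
  -- The sign of τ selects the square k or k + 1; the bound on z makes the coordinate transverse to
  -- the wall the larger one in M.
  rcases le_total τ 0 with h0 | h0
  · rw [abs_of_nonpos h0] at hτ hz ⊢
    have hy : |Real.pi / 2 + τ| = Real.pi / 2 + τ := abs_of_nonneg (by linarith)
    have hM : maxAbs (Real.pi / 2 + τ) z = Real.pi / 2 + τ := by
      rw [maxAbs, hy, max_eq_left (by linarith)]
    rw [add_assoc, hPlane_eq (by rw [hy]; linarith) hz', hM, add_comm (Real.pi / 2) τ,
      Real.sin_add_pi_div_two, Real.cos_add_pi_div_two]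
    ext i
    fin_cases i <;> simp [add_comm]
  · rw [abs_of_nonneg h0] at hτ hz ⊢
    have hy : |τ - Real.pi / 2| = Real.pi / 2 - τ := by
      rw [abs_of_nonpos (by linarith)]; ring
    have hM : maxAbs (τ - Real.pi / 2) z = Real.pi / 2 - τ := by
      rw [maxAbs, hy, max_eq_left (by linarith)]
    have hx : (k : ℝ) * Real.pi + Real.pi / 2 + τ
        = ((k + 1 : ℤ) : ℝ) * Real.pi + (τ - Real.pi / 2) := by push_cast; ring
    rw [hx, hPlane_eq (by rw [hy]; linarith) hz', hM, Real.sin_pi_div_two_sub,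
      Real.cos_pi_div_two_sub]
    have h2 : (τ - Real.pi / 2) ^ 2 = (Real.pi / 2 - τ) ^ 2 := by ring
    rw [h2]
    ext i
    fin_cases i
    · simp [zpow_add₀]; ring
    · simp
    · simp [zpow_add₀]

/-! ### Preimages of points and balls under the Zorich map. -/

theorem exists_zorich_eq {q : E3} (h0 : q 0 ≠ 0) (h2 : q 2 ≠ 0) :
    ∃ (j : ℤ) (y z : ℝ), |y| < Real.pi / 2 ∧ |z| < Real.pi / 2 ∧ y ≠ 0 ∧
      zorich !₂[j * Real.pi + y, z, Real.log ‖q‖] = q := by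
  obtain ⟨j, hj⟩ : ∃ j : ℤ, 0 < (-1 : ℝ) ^ j * q 2 := by
    rcases lt_or_gt_of_ne h2 with h | h
    · exact ⟨1, by simpa using h⟩
    · exact ⟨0, by simpa using h⟩
  have hs := neg_one_zpow_sq j
  set s : ℝ := (-1) ^ j with hsdef
  have hn2 : ‖q‖ ^ 2 = q 0 ^ 2 + q 1 ^ 2 + q 2 ^ 2 := by
    rw [EuclideanSpace.norm_sq_eq]; simp [Fin.sum_univ_three]
  have hq : 0 < ‖q‖ := norm_pos_iff.2 (by rintro rfl; simp at h0)
  set u : ℝ := s * q 2 / ‖q‖ with hu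
  have hu0 : 0 < u := by positivity
  have h0sq : 0 < q 0 ^ 2 := by positivity
  have hu2 : u ^ 2 = q 2 ^ 2 / ‖q‖ ^ 2 := by rw [hu, div_pow, mul_pow, hs, one_mul]
  have hu1 : u < 1 := by
    have : u ^ 2 < 1 := by
      rw [hu2, div_lt_one (by positivity), hn2]; nlinarith [sq_nonneg (q 1)]
    nlinarith
  set m := Real.arccos u with hm
  have hm0 : 0 < m := Real.arccos_pos.2 hu1
  have hm2 : m < Real.pi / 2 := Real.arccos_lt_pi_div_two.2 hu0
  have hcos : Real.cos m = u := Real.cos_arccos (by linarith) hu1.le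
  have hsin : Real.sin m = √(q 0 ^ 2 + q 1 ^ 2) / ‖q‖ := by
    rw [hm, Real.sin_arccos, hu2]
    have : 1 - q 2 ^ 2 / ‖q‖ ^ 2 = (q 0 ^ 2 + q 1 ^ 2) / ‖q‖ ^ 2 := by
      field_simp; linarith
    rw [this, Real.sqrt_div (by positivity), Real.sqrt_sq hq.le]
  set g := maxAbs (q 0) (q 1) with hg
  have hg0 : 0 < g := lt_max_of_lt_left (abs_pos.2 h0)
  -- On a square, h preserves horizontal directions up to sign, so the preimage is (q₀, q₁) rescaled
  -- to have M equal to the polar angle m.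
  set c := m / g with hc
  have hc0 : 0 < c := by positivity
  have hcg : c * g = m := by rw [hc]; field_simp
  have hle0 : |q 0| ≤ g := le_max_left _ _
  have hle1 : |q 1| ≤ g := le_max_right _ _
  have hs1 : |s| = 1 := by rw [hsdef, abs_zpow]; simp
  have hs0 : s ≠ 0 := by intro h; simp [h] at hs
  have hy : |s * (c * q 0)| < Real.pi / 2 := by
    rw [abs_mul, hs1, one_mul, abs_mul, abs_of_pos hc0]; nlinarith
  have hz : |c * q 1| < Real.pi / 2 := by
    rw [abs_mul, abs_of_pos hc0]; nlinarith
  have hM : maxAbs (s * (c * q 0)) (c * q 1) = m := by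
    rw [maxAbs, abs_mul, hs1, one_mul, abs_mul, abs_mul, abs_of_pos hc0,
      ← mul_max_of_nonneg _ _ hc0.le, ← hcg]; rfl
  have hD : √((s * (c * q 0)) ^ 2 + (c * q 1) ^ 2) = c * √(q 0 ^ 2 + q 1 ^ 2) := by
    have : (s * (c * q 0)) ^ 2 + (c * q 1) ^ 2 = c ^ 2 * (q 0 ^ 2 + q 1 ^ 2) := by
      linear_combination (c * q 0) ^ 2 * hs
    rw [this, Real.sqrt_mul (by positivity), Real.sqrt_sq hc0.le]
  refine ⟨j, s * (c * q 0), c * q 1, hy, hz, by positivity, ?_⟩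
  have hform := hPlane_eq (j := j) (l := 0) hy.le hz.le
  rw [hM, hD, hcos, hsin] at hform
  have hR : 0 < √(q 0 ^ 2 + q 1 ^ 2) := Real.sqrt_pos.2 (by positivity)
  simp only [Int.cast_zero, zero_mul, zero_add] at hform
  change Real.exp (Real.log ‖q‖) •
    hPlane (j * Real.pi + s * (c * q 0)) (c * q 1) = q
  rw [hform, Real.exp_log hq]
  ext i
  fin_cases i
  · simp [← hsdef]; field_simp; linear_combination hs
  · simp; field_simp
  · simp [← hsdef, hu]; field_simp; linear_combination hs

/-- Inside a square the strip indices are locally constant, and off its centre the square root in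
the denominator is nonzero. -/
theorem continuousAt_zorich {j : ℤ} {y z t : ℝ} (hy : |y| < Real.pi / 2) (hz : |z| < Real.pi / 2)
    (h0 : y ≠ 0) : ContinuousAt zorich !₂[j * Real.pi + y, z, t] := by
  set p : E3 := !₂[j * Real.pi + y, z, t] with hp
  have hp0 : p 0 - j * Real.pi = y := by simp [hp]
  have hp1 : p 1 = z := by simp [hp]
  have hD : √((p 0 - j * Real.pi) ^ 2 + (p 1) ^ 2) ≠ 0 := by
    rw [hp0, hp1]; exact (Real.sqrt_pos.2 (by positivity)).ne'
  have hev : ∀ᶠ x : E3 in 𝓝 p, Real.exp (x 2) • (!₂[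
      (-1) ^ j * ((x 0 - j * Real.pi) * Real.sin (maxAbs (x 0 - j * Real.pi) (x 1)) /
        √((x 0 - j * Real.pi) ^ 2 + (x 1) ^ 2)),
      (-1) ^ (0 : ℤ) * ((x 1) * Real.sin (maxAbs (x 0 - j * Real.pi) (x 1)) /
        √((x 0 - j * Real.pi) ^ 2 + (x 1) ^ 2)),
      (-1) ^ (j + 0) * Real.cos (maxAbs (x 0 - j * Real.pi) (x 1))] : E3) = zorich x := by
    have h1 : ∀ᶠ x : E3 in 𝓝 p, |x 0 - j * Real.pi| < Real.pi / 2 :=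
      (show ContinuousAt (fun x : E3 => |x 0 - j * Real.pi|) p by fun_prop).eventually_lt
        continuousAt_const (by rwa [hp0])
    have h2 : ∀ᶠ x : E3 in 𝓝 p, |x 1| < Real.pi / 2 :=
      (show ContinuousAt (fun x : E3 => |x 1|) p by fun_prop).eventually_lt
        continuousAt_const (by rwa [hp1])
    filter_upwards [h1, h2] with x hx1 hx2
    have := hPlane_eq (j := j) (l := 0) hx1.le hx2.le
    rw [zorich, ← this]
    simp
  refine ContinuousAt.congr ?_ hev
  unfold maxAbs
  have hexp : ContinuousAt (fun x : E3 => Real.exp (x 2)) p := by fun_prop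
  refine hexp.smul ?_
  refine (PiLp.continuous_toLp 2 _).continuousAt.comp (continuousAt_pi.2 fun i => ?_)
  fin_cases i
  · simp only [Fin.zero_eta, Matrix.cons_val_zero]
    refine ContinuousAt.mul (by fun_prop) (ContinuousAt.div (by fun_prop) (by fun_prop) hD)
  · simp only [Fin.mk_one, Matrix.cons_val_one, Matrix.cons_val_zero]
    refine ContinuousAt.mul (by fun_prop) (ContinuousAt.div (by fun_prop) (by fun_prop) hD)
  · simp only [Fin.reduceFinMk, Matrix.cons_val]
    fun_prop

theorem eventually_add_ne_zero (a : ℝ) : ∀ᶠ s : ℝ in 𝓝[≠] 0, a + s ≠ 0 := by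
  by_cases ha : a = 0
  · filter_upwards [self_mem_nhdsWithin] with s hs
    simpa [ha] using hs
  · have h : ContinuousAt (fun s : ℝ => a + s) 0 := by fun_prop
    exact (h.eventually_ne (by simpa using ha)).filter_mono nhdsWithin_le_nhds

/-- An open ball contains the image under the Zorich map of an open ball. -/
theorem exists_ball_zorich_subset (q : E3) {δ : ℝ} (hδ : 0 < δ) :
    ∃ (p : E3) (ρ : ℝ), 0 < ρ ∧ ∀ x ∈ Metric.ball p ρ, zorich x ∈ Metric.ball q δ := by
  -- A small perturbation avoids the axis and the equatorial plane, so that the preimage lies inside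
  -- a square and off its centre.
  obtain ⟨q', hq', h0, h2⟩ : ∃ q' ∈ Metric.ball q δ, q' 0 ≠ 0 ∧ q' 2 ≠ 0 := by
    have hc : ContinuousAt (fun s : ℝ => q + s • (!₂[1, 0, 1] : E3)) 0 := by fun_prop
    have hball : ∀ᶠ y in 𝓝 q, dist y q < δ := Metric.ball_mem_nhds q hδ
    have e1 : ∀ᶠ s : ℝ in 𝓝[≠] 0, q + s • (!₂[1, 0, 1] : E3) ∈ Metric.ball q δ :=
      (hc.eventually (by simpa using hball)).filter_mono nhdsWithin_le_nhds
    obtain ⟨s, hs⟩ := (e1.and ((eventually_add_ne_zero (q 0)).and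
      (eventually_add_ne_zero (q 2)))).exists
    exact ⟨_, hs.1, by simpa using hs.2.1, by simpa using hs.2.2⟩
  obtain ⟨j, y, z, hy, hz, hy0, he⟩ := exists_zorich_eq h0 h2
  have hc := continuousAt_zorich (j := j) (t := Real.log ‖q'‖) hy hz hy0
  have hmem := hc.preimage_mem_nhds (Metric.isOpen_ball.mem_nhds (by rwa [he]))
  obtain ⟨ρ, hρ, hsub⟩ := Metric.mem_nhds_iff.1 hmem
  exact ⟨_, ρ, hρ, fun x hx => hsub hx⟩

/-! ### Polar coordinates on the image of a neighbourhood of a wall. -/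

theorem sqrt_sq_add_sq_sub_le (A z z' : ℝ) : |√(A ^ 2 + z ^ 2) - √(A ^ 2 + z' ^ 2)| ≤ |z - z'| := by
  have h := abs_norm_sub_norm_le (!₂[A, z] : EuclideanSpace ℝ (Fin 2)) !₂[A, z']
  rw [EuclideanSpace.norm_eq, EuclideanSpace.norm_eq, EuclideanSpace.norm_eq] at h
  simpa [Fin.sum_univ_two, Real.sqrt_sq_eq_abs] using h

theorem abs_cos_slope_sub_le {A : ℝ} (hA : 0 < A) (z z' : ℝ) :
    |A / √(A ^ 2 + z ^ 2) - A / √(A ^ 2 + z' ^ 2)| ≤ |z - z'| / A := by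
  have hD : A ≤ √(A ^ 2 + z ^ 2) := Real.le_sqrt_of_sq_le (by nlinarith [sq_nonneg z])
  have hD' : A ≤ √(A ^ 2 + z' ^ 2) := Real.le_sqrt_of_sq_le (by nlinarith [sq_nonneg z'])
  have h := sqrt_sq_add_sq_sub_le A z' z
  set D := √(A ^ 2 + z ^ 2)
  set D' := √(A ^ 2 + z' ^ 2)
  have h0 : 0 < D := by linarith
  have h0' : 0 < D' := by linarith
  have he : A / D - A / D' = A * (D' - D) / (D * D') := by field_simp
  rw [he, abs_div, abs_mul, abs_of_pos hA, abs_of_pos (mul_pos h0 h0'), abs_sub_comm z,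
    div_le_div_iff₀ (by positivity) hA]
  have h3 : A * A ≤ D * D' := by gcongr
  calc A * |D' - D| * A = |D' - D| * (A * A) := by ring
    _ ≤ |z' - z| * (D * D') := by gcongr

theorem abs_sin_slope_sub_le {A : ℝ} (hA : 0 < A) (z z' : ℝ) :
    |z / √(A ^ 2 + z ^ 2) - z' / √(A ^ 2 + z' ^ 2)| ≤ 2 * |z - z'| / A := by
  have hD : A ≤ √(A ^ 2 + z ^ 2) := Real.le_sqrt_of_sq_le (by nlinarith [sq_nonneg z])
  have hD' : A ≤ √(A ^ 2 + z' ^ 2) := Real.le_sqrt_of_sq_le (by nlinarith [sq_nonneg z'])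
  have hz' : |z'| ≤ √(A ^ 2 + z' ^ 2) := Real.abs_le_sqrt (by nlinarith [sq_nonneg A])
  have h := sqrt_sq_add_sq_sub_le A z' z
  set D := √(A ^ 2 + z ^ 2)
  set D' := √(A ^ 2 + z' ^ 2)
  have h0 : 0 < D := by linarith
  have h0' : 0 < D' := by linarith
  have he : z / D - z' / D' = ((z - z') * D' + z' * (D' - D)) / (D * D') := by field_simp; ring
  rw [he, abs_div, abs_of_pos (mul_pos h0 h0'), div_le_div_iff₀ (by positivity) hA]
  rw [abs_sub_comm z' z] at h
  have h1 : |(z - z') * D' + z' * (D' - D)| ≤ 2 * |z - z'| * D' := by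
    refine (abs_add_le _ _).trans ?_
    rw [abs_mul, abs_mul, abs_of_pos h0']
    have : |z'| * |D' - D| ≤ D' * |z - z'| := by gcongr
    linarith
  calc _ ≤ 2 * |z - z'| * D' * D := by gcongr
    _ = _ := by ring

/-- The map `(L, z) ↦ Q e^L (A, z) / √(A² + z²)` moves points at most by a constant times the
modulus of the image point. -/
theorem abs_exp_mul_sub_le {u u' L L' d Q : ℝ} (hQ : 0 ≤ Q) (hu : |u| ≤ 1) (huu : |u - u'| ≤ d)
    (hL : |L - L'| ≤ 1) :
    |Q * Real.exp L * u - Q * Real.exp L' * u'| ≤ Q * Real.exp L' * (2 * |L - L'| + d) := by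
  have h1 : Q * Real.exp L * u - Q * Real.exp L' * u' =
      Q * Real.exp L' * ((Real.exp (L - L') - 1) * u + (u - u')) := by
    have : Real.exp L = Real.exp L' * Real.exp (L - L') := by rw [← Real.exp_add]; ring_nf
    rw [this]; ring
  rw [h1, abs_mul, abs_of_nonneg (by positivity : 0 ≤ Q * Real.exp L')]
  refine mul_le_mul_of_nonneg_left ((abs_add_le _ _).trans ?_) (by positivity)
  have h2 := Real.abs_exp_sub_one_le hL
  rw [abs_mul]
  have : |Real.exp (L - L') - 1| * |u| ≤ 2 * |L - L'| * 1 := by gcongr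
  linarith

/-- A point of the plane at bounded distance from `Q (A, z) / √(A² + z²)` has the form
`Q e^L (A, z') / √(A² + z'²)` with `z' - z` and `L` of order `1 / Q`. -/
theorem exists_polar_preimage {A z Q X Y : ℝ} (hA0 : 0 < A) (hA : A ≤ 2) (hz : |z| ≤ A)
    (hQ : 16 ≤ Q) (hX : |X - Q * (A / √(A ^ 2 + z ^ 2))| ≤ 4)
    (hY : |Y - Q * (z / √(A ^ 2 + z ^ 2))| ≤ 4) :
    ∃ z' L : ℝ, |z' - z| ≤ 128 / Q ∧ |L| ≤ 16 / Q ∧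
      Q * Real.exp L * (A / √(A ^ 2 + z' ^ 2)) = X ∧
      Q * Real.exp L * (z' / √(A ^ 2 + z' ^ 2)) = Y := by
  have hD : 0 < √(A ^ 2 + z ^ 2) := Real.sqrt_pos.2 (by positivity)
  have hD2 : √(A ^ 2 + z ^ 2) ^ 2 = A ^ 2 + z ^ 2 := Real.sq_sqrt (by positivity)
  set D := √(A ^ 2 + z ^ 2)
  set X₀ := Q * (A / D) with hX0
  set Y₀ := Q * (z / D) with hY0
  have hQ0 : 0 < Q := by linarith
  have hsum : X₀ ^ 2 + Y₀ ^ 2 = Q ^ 2 := by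
    have : X₀ ^ 2 + Y₀ ^ 2 = Q ^ 2 * (A ^ 2 + z ^ 2) / D ^ 2 := by
      rw [hX0, hY0]; field_simp
    rw [this, hD2]; field_simp
  have hX0pos : 0 < X₀ := by positivity
  have hYX : |Y₀| ≤ X₀ := by
    rw [hY0, hX0, abs_mul, abs_of_pos hQ0, abs_div, abs_of_pos hD]; gcongr
  have hXlow : Q / 2 ≤ X₀ := by
    have := sq_abs Y₀
    nlinarith [abs_nonneg Y₀]
  have hXup : X₀ ≤ Q := by nlinarith [sq_nonneg Y₀]
  have hYup : |Y₀| ≤ Q := hYX.trans hXup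
  -- The sharp constant is √2; 3/2 keeps the linear error 8(X₀ + |Y₀|) in S² below 16Q.
  have hadd : X₀ + |Y₀| ≤ 3 / 2 * Q := by
    refine abs_le_of_sq_le_sq' ?_ (by positivity) |>.2
    nlinarith [sq_abs Y₀, sq_nonneg (X₀ - |Y₀|)]
  obtain ⟨hX1, hX2⟩ := abs_le.1 hX
  have hXq : Q / 4 ≤ X := by linarith
  have hXpos : 0 < X := by linarith
  have hS : 0 < √(X ^ 2 + Y ^ 2) := Real.sqrt_pos.2 (by positivity)
  have hS2 : √(X ^ 2 + Y ^ 2) ^ 2 = X ^ 2 + Y ^ 2 := Real.sq_sqrt (by positivity)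
  set S := √(X ^ 2 + Y ^ 2)
  have hdX : |X ^ 2 - X₀ ^ 2| ≤ 8 * X₀ + 16 := by
    have : X ^ 2 - X₀ ^ 2 = (X - X₀) * (X - X₀ + 2 * X₀) := by ring
    rw [this, abs_mul]
    have h2 : |X - X₀ + 2 * X₀| ≤ 4 + 2 * X₀ := by
      refine (abs_add_le _ _).trans ?_
      rw [abs_of_pos (by linarith : 0 < 2 * X₀)]; linarith
    calc _ ≤ 4 * (4 + 2 * X₀) := by gcongr
      _ = _ := by ring
  have hdY : |Y ^ 2 - Y₀ ^ 2| ≤ 8 * |Y₀| + 16 := by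
    have : Y ^ 2 - Y₀ ^ 2 = (Y - Y₀) * (Y - Y₀ + 2 * Y₀) := by ring
    rw [this, abs_mul]
    have h2 : |Y - Y₀ + 2 * Y₀| ≤ 4 + 2 * |Y₀| := by
      refine (abs_add_le _ _).trans ?_
      rw [abs_mul, abs_two]; linarith
    calc _ ≤ 4 * (4 + 2 * |Y₀|) := by gcongr
      _ = _ := by ring
  have hSup : S ≤ Q + 8 := by
    have := (abs_le.1 hdX).2
    have := (abs_le.1 hdY).2
    nlinarith
  have hSlow : Q - 8 ≤ S := by
    have := (abs_le.1 hdX).1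
    have := (abs_le.1 hdY).1
    by_contra! hcon
    nlinarith
  have hz_eq : z = A * (Y₀ / X₀) := by rw [hX0, hY0]; field_simp
  -- The first witness puts (A, z') on the ray through (X, Y); the second adjusts the modulus from Q
  -- to S.
  refine ⟨A * (Y / X), Real.log (S / Q), ?_, ?_, ?_, ?_⟩
  · have he : A * (Y / X) - z = A * ((Y - Y₀) * X₀ - Y₀ * (X - X₀)) / (X * X₀) := by
      conv_lhs => rw [hz_eq]
      field_simp; ring
    have hnum : |(Y - Y₀) * X₀ - Y₀ * (X - X₀)| ≤ 8 * Q := by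
      refine (abs_sub _ _).trans ?_
      rw [abs_mul (Y - Y₀), abs_mul Y₀, abs_of_pos hX0pos]
      have h1 : |Y - Y₀| * X₀ ≤ 4 * Q := by gcongr
      have h2 : |Y₀| * |X - X₀| ≤ Q * 4 := by gcongr
      linarith
    rw [he, abs_div, abs_mul, abs_of_pos hA0, abs_of_pos (mul_pos hXpos hX0pos),
      div_le_div_iff₀ (by positivity) hQ0]
    have h1 : A * |(Y - Y₀) * X₀ - Y₀ * (X - X₀)| ≤ 2 * (8 * Q) := by gcongr
    have h2 : (Q / 4) * (Q / 2) ≤ X * X₀ := by gcongr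
    nlinarith
  · rw [abs_le]
    constructor
    · have h1 := Real.one_sub_inv_le_log_of_pos (div_pos hS hQ0)
      refine le_trans ?_ h1
      rw [inv_div, neg_le_sub_iff_le_add, div_le_iff₀ hS]
      have : (1 + 16 / Q) * (Q - 8) ≤ (1 + 16 / Q) * S := by gcongr
      have h3 : (1 + 16 / Q) * (Q - 8) = Q + 8 - 128 / Q := by field_simp; ring
      have h4 : 128 / Q ≤ 8 := by rw [div_le_iff₀ hQ0]; linarith
      linarith
    · refine (Real.log_le_sub_one_of_pos (div_pos hS hQ0)).trans ?_
      rw [sub_le_iff_le_add, div_le_iff₀ hQ0, add_mul, div_mul_cancel₀ _ hQ0.ne']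
      linarith
  all_goals
    have hroot : √(A ^ 2 + (A * (Y / X)) ^ 2) = A * S / X := by
      rw [Real.sqrt_eq_iff_mul_self_eq (by positivity) (by positivity)]
      have : A * S / X * (A * S / X) = A ^ 2 * S ^ 2 / X ^ 2 := by ring
      rw [this, hS2]; field_simp
    rw [Real.exp_log (div_pos hS hQ0), hroot]
    field_simp

/-! ### Choice of crossings and approximation modulo periods. -/

/-- With 2η ≤ π|a| ≤ π - 2η, a shift by πa takes a point within η of one side to distance at least η
from all sides. Here πa is the change in the second coordinate between consecutive crossings. -/
theorem exists_shift_away_from_sides {a : ℝ} (h0 : a ≠ 0) (h1 : |a| < 1) :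
    ∃ η > 0, ∀ x : ℝ, ∃ l : ℤ, |x - l * Real.pi| ≤ Real.pi / 2 - η ∨
      |x + Real.pi * a - l * Real.pi| ≤ Real.pi / 2 - η := by
  have hpi := Real.pi_pos
  have hpos := abs_pos.2 h0
  refine ⟨Real.pi * min |a| (1 - |a|) / 2, ?_, fun x => ?_⟩
  · have : 0 < min |a| (1 - |a|) := lt_min hpos (by linarith)
    positivity
  set η := Real.pi * min |a| (1 - |a|) / 2 with hη
  have e1 : 2 * η ≤ Real.pi * |a| := by
    have := mul_le_mul_of_nonneg_left (min_le_left |a| (1 - |a|)) hpi.le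
    linarith
  have e2 : 2 * η ≤ Real.pi - Real.pi * |a| := by
    have := mul_le_mul_of_nonneg_left (min_le_right |a| (1 - |a|)) hpi.le
    linarith
  have e0 : 0 < η := by
    have : 0 < min |a| (1 - |a|) := lt_min hpos (by linarith)
    positivity
  obtain ⟨j, y, hy, rfl⟩ := exists_strip x
  obtain ⟨hy1, hy2⟩ := abs_le.1 hy
  rcases le_or_gt (|y|) (Real.pi / 2 - η) with h | h
  · exact ⟨j, Or.inl (by simpa using h)⟩
  · rcases lt_abs.1 h with hy' | hy' <;> rcases lt_or_gt_of_ne h0 with ha | ha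
    · rw [abs_of_neg ha] at e1 e2
      exact ⟨j, Or.inr (abs_le.2 ⟨by linarith, by linarith⟩)⟩
    · rw [abs_of_pos ha] at e1 e2
      exact ⟨j + 1, Or.inr (abs_le.2 ⟨by push_cast; linarith, by push_cast; linarith⟩)⟩
    · rw [abs_of_neg ha] at e1 e2
      exact ⟨j - 1, Or.inr (abs_le.2 ⟨by push_cast; linarith, by push_cast; linarith⟩)⟩
    · rw [abs_of_pos ha] at e1 e2
      exact ⟨j, Or.inr (abs_le.2 ⟨by linarith, by linarith⟩)⟩

/-- Controls the third coordinate of the image: N sin(c/N) tends to c, and the exponential factor is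
1 + O(1/N). -/
theorem eventually_mul_sin_div_mul_exp_near (c K : ℝ) {ρ : ℝ} (hρ : 0 < ρ) :
    ∀ᶠ N : ℝ in atTop, ∀ x, |x| ≤ K / N → |N * Real.sin (c / N) * Real.exp x - c| < ρ := by
  have hdiv : ∀ C : ℝ, Tendsto (fun N : ℝ => C / N) atTop (𝓝 0) := fun C =>
    tendsto_const_nhds.div_atTop tendsto_id
  have h1 : Tendsto (fun N : ℝ => c * Real.sinc (c / N)) atTop (𝓝 c) := by
    have := (Real.continuous_sinc.tendsto 0).comp (hdiv c)
    simpa using this.const_mul c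
  have h2 := h1.eventually (Metric.ball_mem_nhds c (half_pos hρ))
  have h3 := (hdiv K).eventually (gt_mem_nhds one_pos)
  have h4 := (hdiv (|c| * (2 * K))).eventually (gt_mem_nhds (half_pos hρ))
  filter_upwards [h2, h3, h4, eventually_gt_atTop 0] with N hN2 hN3 hN4 hN x hx
  have e1 : N * Real.sin (c / N) = c * Real.sinc (c / N) := by
    rcases eq_or_ne c 0 with rfl | hc
    · simp
    · rw [Real.sinc_of_ne_zero (by positivity)]; field_simp
  have e2 : |N * Real.sin (c / N)| ≤ |c| := by
    rw [abs_mul, abs_of_pos hN]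
    have := Real.abs_sin_le_abs (x := c / N)
    rw [abs_div, abs_of_pos hN] at this
    calc N * |Real.sin (c / N)| ≤ N * (|c| / N) := by gcongr
      _ = |c| := by field_simp
  have e3 := Real.abs_exp_sub_one_le (hx.trans hN3.le)
  have e4 : N * Real.sin (c / N) * Real.exp x - c =
    N * Real.sin (c / N) * (Real.exp x - 1) + (N * Real.sin (c / N) - c) := by ring
  rw [e4]
  refine (abs_add_le _ _).trans_lt ?_
  rw [abs_mul]
  have e5 : |N * Real.sin (c / N)| * |Real.exp x - 1| ≤ |c| * (2 * (K / N)) := by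
    gcongr
    exact e3.trans (by gcongr)
  have e6 : |c| * (2 * (K / N)) = |c| * (2 * K) / N := by ring
  rw [← e1, Real.dist_eq] at hN2
  linarith

/-- Rounding modulo 2π leaves an error of at most π < 4. -/
theorem exists_int_near (w p : ℝ) : ∃ m : ℤ, |p + 2 * Real.pi * m - w| ≤ 4 := by
  have hpi := Real.pi_pos
  obtain ⟨m, hm⟩ : ∃ m : ℤ, |(w - p) / (2 * Real.pi) - m| ≤ 1 / 2 :=
    ⟨_, abs_sub_round _⟩
  refine ⟨m, ?_⟩
  have : p + 2 * Real.pi * m - w = -((w - p) / (2 * Real.pi) - m) * (2 * Real.pi) := by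
    field_simp; ring
  rw [this, abs_mul, abs_neg, abs_of_pos (by positivity : 0 < 2 * Real.pi)]
  nlinarith [Real.pi_lt_four]

theorem dist_le_sum_three (x y : E3) : dist x y ≤ |x 0 - y 0| + |x 1 - y 1| + |x 2 - y 2| := by
  rw [EuclideanSpace.dist_eq, Fin.sum_univ_three]
  refine Real.sqrt_le_iff.2 ⟨by positivity, ?_⟩
  simp only [Real.dist_eq]
  nlinarith [abs_nonneg (x 0 - y 0), abs_nonneg (x 1 - y 1), abs_nonneg (x 2 - y 2),
    mul_nonneg (abs_nonneg (x 0 - y 0)) (abs_nonneg (x 1 - y 1)),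
    mul_nonneg (abs_nonneg (x 0 - y 0)) (abs_nonneg (x 2 - y 2)),
    mul_nonneg (abs_nonneg (x 1 - y 1)) (abs_nonneg (x 2 - y 2))]

theorem dist_le_sum_two (x y : EuclideanSpace ℝ (Fin 2)) :
    dist x y ≤ |x 0 - y 0| + |x 1 - y 1| := by
  rw [EuclideanSpace.dist_eq, Fin.sum_univ_two]
  refine Real.sqrt_le_iff.2 ⟨by positivity, ?_⟩
  simp only [Real.dist_eq]
  nlinarith [mul_nonneg (abs_nonneg (x 0 - y 0)) (abs_nonneg (x 1 - y 1))]

theorem abs_sub_le_dist {n : ℕ} (x y : EuclideanSpace ℝ (Fin n)) (i : Fin n) :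
    |x i - y i| ≤ dist x y := by
  rw [dist_eq_norm]
  simpa using PiLp.norm_apply_le (x - y) i

/-- A point whose first two coordinates are near a translate of those of `p` by periods has the
same image under the Zorich map as a point near `p`. -/
theorem zorich_mem_of_near {p w : E3} {ρ : ℝ} {V : Set E3}
    (hV : ∀ x ∈ Metric.ball p ρ, zorich x ∈ V) {m n : ℤ}
    (h0 : |w 0 - (p 0 + 2 * Real.pi * m)| < ρ / 3)
    (h1 : |w 1 - (p 1 + 2 * Real.pi * n)| < ρ / 3) (h2 : |w 2 - p 2| < ρ / 3) :
    zorich w ∈ V := by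
  have h := hV !₂[w 0 - 2 * Real.pi * m, w 1 - 2 * Real.pi * n, w 2] (by
    rw [Metric.mem_ball]
    refine (dist_le_sum_three _ _).trans_lt ?_
    have e0 : w 0 - 2 * Real.pi * m - p 0 = w 0 - (p 0 + 2 * Real.pi * m) := by ring
    have e1 : w 1 - 2 * Real.pi * n - p 1 = w 1 - (p 1 + 2 * Real.pi * n) := by ring
    simp only [Matrix.cons_val_zero, Matrix.cons_val_one, Matrix.cons_val, e0, e1]
    linarith)
  have he : zorich !₂[w 0 - 2 * Real.pi * m, w 1 - 2 * Real.pi * n, w 2] = zorich w := by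
    rw [zorich, zorich, ← hPlane_periodic m n]
    simp
  rwa [he] at h

/-! ### Porosity from wall crossings. -/

set_option maxHeartbeats 1000000 in
/-- If a line with parameter `x` crosses, at the time `T - τ`, a side `x₁ = const` of a square
away from the corners, then the lines with parameters in some ball near `x` meet the preimage
of `V` at the time `T`. The quantities `N` and `1 / (N T)` are the size of the image of the
crossing point, and the scale of the ball. -/
theorem ball_subset_of_crossing {P p : E3} {V : Set E3} {ρ : ℝ}
    (hV : ∀ x ∈ Metric.ball p ρ, zorich x ∈ V) {x : EuclideanSpace ℝ (Fin 2)}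
    {κ N T τ A Q z : ℝ} {k l : ℤ} (hκ25 : κ ≤ 1 / 25) (hκρ : κ ≤ ρ / 15000)
    (hT : 1 ≤ T) (hN : 64 ≤ N)
    (hτ : τ = -((-1) ^ (k + l) * (p 2 / N))) (hτ2 : |τ| ≤ 1 / 2)
    (hPT : P 0 + T = k * Real.pi + Real.pi / 2 + τ)
    (hNdef : N * Real.exp (τ * x 1) = Real.exp (P 2 + T * x 1))
    (hAdef : A = Real.pi / 2 - |τ|) (hz : z = P 1 + T * x 0 - l * Real.pi)
    (hzA : |z| ≤ A - 300 / N)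
    (hQ : Q = Real.cos τ * Real.exp (P 2 + T * x 1)) (hQ1 : N / 2 ≤ Q) (hQ2 : Q ≤ 2 * N)
    (hthird : ∀ y : ℝ, |y| ≤ (|p 2 * x 1| + 44) / N →
      |N * Real.sin (p 2 / N) * Real.exp y - p 2| < ρ / 3) :
    ∃ y, Metric.ball y (κ * (300 / (N * T))) ⊆ Metric.closedBall x (300 / (N * T)) ∩
      {x' | ∃ t : ℝ, zorich (zorich (P + t • !₂[1, x' 0, x' 1])) ∈ V} := by
  have hN0 : 0 < N := by linarith
  have hT0 : 0 < T := by linarith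
  have hQ0 : 32 ≤ Q := by linarith
  have hA1 : 1 ≤ A := by linarith [Real.pi_gt_three]
  have hA2 : A ≤ 2 := by linarith [Real.pi_lt_four, abs_nonneg τ]
  have hzA' : |z| ≤ A := hzA.trans (by have : 0 < 300 / N := by positivity
                                       linarith)
  have hs1 := neg_one_zpow_sq k
  have hs2 := neg_one_zpow_sq l
  -- The target is the translate of p by periods nearest to the horizontal part of the image of the
  -- line x at time T.
  obtain ⟨m, hm⟩ := exists_int_near ((-1) ^ k * (Q * (A / √(A ^ 2 + z ^ 2)))) (p 0)
  obtain ⟨n, hn⟩ := exists_int_near ((-1) ^ l * (Q * (z / √(A ^ 2 + z ^ 2)))) (p 1)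
  obtain ⟨z', L, hz', hL, hX, hY⟩ := exists_polar_preimage (A := A) (z := z) (Q := Q)
    (X := (-1) ^ k * (p 0 + 2 * Real.pi * m)) (Y := (-1) ^ l * (p 1 + 2 * Real.pi * n))
    (by linarith) hA2 hzA' (by linarith)
    (by
      rw [← abs_neg_one_zpow_mul k]
      convert hm using 2
      linear_combination (p 0 + 2 * Real.pi * m) * hs1)
    (by
      rw [← abs_neg_one_zpow_mul l]
      convert hn using 2
      linear_combination (p 1 + 2 * Real.pi * n) * hs2)
  have hQN : 1 / Q ≤ 2 / N := by
    rw [div_le_div_iff₀ (by linarith) hN0]; linarith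
  have hz'N : |z' - z| ≤ 256 / N := hz'.trans (by
    have : 128 / Q = 128 * (1 / Q) := by ring
    have : 256 / N = 128 * (2 / N) := by ring
    linarith)
  have hLN : |L| ≤ 32 / N := hL.trans (by
    have : 16 / Q = 16 * (1 / Q) := by ring
    have : 32 / N = 16 * (2 / N) := by ring
    linarith)
  have hL2 : |L| ≤ 1 / 2 := hLN.trans (by rw [div_le_div_iff₀ hN0 (by norm_num)]; linarith)
  have hexpL : Real.exp L ≤ 2 := by
    have := Real.abs_exp_sub_one_le (x := L) (by linarith)
    linarith [(abs_le.1 this).2]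
  -- At time T the line with this parameter is displaced from that of x by z' - z in the second
  -- coordinate and by L in height.
  refine ⟨!₂[x 0 + (z' - z) / T, x 1 + L / T], fun x' hx' => ?_⟩
  set y : EuclideanSpace ℝ (Fin 2) := !₂[x 0 + (z' - z) / T, x 1 + L / T] with hy
  have hy0 : y 0 = x 0 + (z' - z) / T := rfl
  have hy1 : y 1 = x 1 + L / T := rfl
  have hscale : T * (κ * (300 / (N * T))) = 300 * κ / N := by field_simp
  have hx'0 : T * |x' 0 - y 0| ≤ 300 * κ / N := by
    rw [← hscale]; gcongr; exact (abs_sub_le_dist x' y 0).trans hx'.le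
  have hx'1 : T * |x' 1 - y 1| ≤ 300 * κ / N := by
    rw [← hscale]; gcongr; exact (abs_sub_le_dist x' y 1).trans hx'.le
  have hκN : 300 * κ / N ≤ 12 / N := by gcongr; linarith
  -- The constant is 300 = 256 + 32 + 12: the displacements z' - z and L, and the hole radius, for
  -- which κ ≤ 1/25 is needed.
  have hdist : dist x' x ≤ 300 / (N * T) := by
    have h1 : dist y x ≤ 288 / (N * T) := by
      refine (dist_le_sum_two y x).trans ?_
      rw [hy0, hy1, add_sub_cancel_left, add_sub_cancel_left, abs_div, abs_div, abs_of_pos hT0,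
        ← add_div, ← div_div]
      gcongr
      have : 288 / N = 256 / N + 32 / N := by ring
      linarith
    have h2 : dist x' y ≤ 12 / (N * T) := by
      refine (Metric.mem_ball.1 hx').le.trans ?_
      have : (12 : ℝ) / (N * T) = 1 / 25 * (300 / (N * T)) := by ring
      rw [this]; gcongr
    have h3 : 300 / (N * T) = 12 / (N * T) + 288 / (N * T) := by ring
    linarith [dist_triangle x' y x]
  refine ⟨hdist, T, ?_⟩
  set z'' := P 1 + T * x' 0 - l * Real.pi with hz''
  set L'' := T * (x' 1 - x 1) with hL''
  have hzz : |z'' - z'| ≤ 300 * κ / N := by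
    have : z'' - z' = T * (x' 0 - y 0) := by rw [hy0, hz'']; field_simp; rw [hz]; ring
    rw [this, abs_mul, abs_of_pos hT0]; exact hx'0
  have hLL : |L'' - L| ≤ 300 * κ / N := by
    have : L'' - L = T * (x' 1 - y 1) := by rw [hy1, hL'']; field_simp; ring
    rw [this, abs_mul, abs_of_pos hT0]; exact hx'1
  have h12 : 12 / N ≤ 1 := by rw [div_le_one hN0]; linarith
  have hz''A : |z''| ≤ A := by
    have h1 : z'' = (z'' - z') + (z' - z) + z := by ring
    have h2 := abs_add_three (z'' - z') (z' - z) z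
    rw [← h1] at h2
    have h3 : 300 / N = 12 / N + 256 / N + 32 / N := by ring
    have h4 : 0 < 32 / N := by positivity
    linarith
  have hQexp : Q * Real.exp L'' = Real.cos τ * Real.exp (P 2 + T * x' 1) := by
    rw [hQ, mul_assoc, ← Real.exp_add]; congr 2; rw [hL'']; ring
  -- Q = O(N) cancels the 1/N in the parameter error, leaving 4800κ; this is the source of κ ≤
  -- ρ/15000.
  have hbound : Q * Real.exp L * (2 * |L'' - L| + 2 * |z'' - z'| / A) < ρ / 3 := by
    have h1 : 2 * |z'' - z'| / A ≤ 2 * |z'' - z'| := div_le_self (by positivity) hA1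
    have hpos : 0 ≤ 300 * κ / N := (abs_nonneg _).trans hzz
    calc Q * Real.exp L * (2 * |L'' - L| + 2 * |z'' - z'| / A)
        ≤ (2 * N) * 2 * (4 * (300 * κ / N)) := by
          gcongr; linarith
      _ = 4800 * κ := by field_simp; ring
      _ < ρ / 3 := by
          have hρ : 0 < ρ := by
            have := (abs_nonneg _).trans_lt (hthird 0 (by simp; positivity))
            linarith
          linarith
  have hu1 : |A / √(A ^ 2 + z'' ^ 2)| ≤ 1 := by
    rw [abs_div, abs_of_nonneg (Real.sqrt_nonneg _)]
    exact div_le_one_of_le₀ (Real.abs_le_sqrt (by nlinarith [sq_nonneg z''])) (Real.sqrt_nonneg _)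
  have hu2 : |z'' / √(A ^ 2 + z'' ^ 2)| ≤ 1 := by
    rw [abs_div, abs_of_nonneg (Real.sqrt_nonneg _)]
    exact div_le_one_of_le₀ (Real.abs_le_sqrt (by nlinarith [sq_nonneg A])) (Real.sqrt_nonneg _)
  have hcos : |A / √(A ^ 2 + z'' ^ 2) - A / √(A ^ 2 + z' ^ 2)| ≤ 2 * |z'' - z'| / A :=
    (abs_cos_slope_sub_le (by linarith) z'' z').trans (div_le_div_of_nonneg_right
      (by linarith [abs_nonneg (z'' - z')]) (by linarith))
  have hfirst := abs_exp_mul_sub_le (by linarith : 0 ≤ Q) hu1 hcos (hLL.trans (hκN.trans h12))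
  have hsecond := abs_exp_mul_sub_le (by linarith : 0 ≤ Q) hu2
    (abs_sin_slope_sub_le (by linarith) z'' z') (hLL.trans (hκN.trans h12))
  rw [hX] at hfirst
  rw [hY] at hsecond
  have hcoord : zorich (P + T • !₂[1, x' 0, x' 1]) = Real.exp (P 2 + T * x' 1) •
      hPlane (k * Real.pi + Real.pi / 2 + τ) (l * Real.pi + z'') := by
    rw [zorich, ← hPT, hz'']
    simp
  have hedge := hPlane_edge (k := k) (l := l) (τ := τ) (z := z'')
    (by linarith [Real.pi_gt_three]) (by rw [← hAdef]; exact hz''A)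
  rw [← hAdef] at hedge
  refine zorich_mem_of_near hV (m := m) (n := n) ?_ ?_ ?_
  · rw [hcoord, hedge]
    refine lt_of_eq_of_lt ?_ (hfirst.trans_lt hbound)
    rw [← abs_neg_one_zpow_mul k, hQexp]
    congr 1
    simp
    linear_combination (Real.exp (P 2 + T * x' 1) * (A * Real.cos τ / √(A ^ 2 + z'' ^ 2))) * hs1
  · rw [hcoord, hedge]
    refine lt_of_eq_of_lt ?_ (hsecond.trans_lt hbound)
    rw [← abs_neg_one_zpow_mul l, hQexp]
    congr 1
    simp
    linear_combination (Real.exp (P 2 + T * x' 1) * (z'' * Real.cos τ / √(A ^ 2 + z'' ^ 2))) * hs2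
  · rw [hcoord, hedge]
    -- The sign in τ compensates for the orientation of the square, so the third coordinate
    -- approximates p₂ and not -p₂.
    have hsin : -((-1) ^ (k + l) * Real.sin τ) = Real.sin (p 2 / N) := by
      rcases Int.even_or_odd (k + l) with h | h
      · rw [hτ, h.neg_one_zpow]; simp
      · rw [hτ, h.neg_one_zpow]; simp
    have hexp : Real.exp (P 2 + T * x' 1) = N * Real.exp (τ * x 1 + L'') := by
      rw [Real.exp_add (τ * x 1), ← mul_assoc, hNdef, ← Real.exp_add]; congr 1; rw [hL'']; ring
    have h := hthird (τ * x 1 + L'') (by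
      have h1 : |τ * x 1| = |p 2 * x 1| / N := by
        rw [hτ, abs_mul, abs_neg, abs_neg_one_zpow_mul, abs_div, abs_of_pos hN0, abs_mul]; ring
      have h2 : L'' = (L'' - L) + L := by ring
      have h3 := abs_add_le (L'' - L) L
      rw [← h2] at h3
      have h4 := abs_add_le (τ * x 1) L''
      have h5 : (|p 2 * x 1| + 44) / N = |p 2 * x 1| / N + (12 / N + 32 / N) := by ring
      linarith)
    refine lt_of_eq_of_lt ?_ h
    congr 2
    simp only [PiLp.smul_apply, smul_eq_mul, Matrix.cons_val, hsin, hexp]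
    ring

/-- The set of parameters whose lines are mapped into the complement of an open set by `𝒵 ∘ 𝒵`
is porous, as follows from the crossings of the planes `x₁ = kπ + π/2` for large `k`. -/
theorem porous_face (P p : E3) {V : Set E3} {ρ : ℝ} (hρ : 0 < ρ)
    (hV : ∀ x ∈ Metric.ball p ρ, zorich x ∈ V) {x : EuclideanSpace ℝ (Fin 2)}
    (hx : x ∈ faceParam) :
    ∃ κ : ℝ, 0 < κ ∧ ∀ ε > 0, ∃ r, 0 < r ∧ r < ε ∧ ∃ y,
      Metric.ball y (κ * r) ⊆ Metric.closedBall x r ∩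
        {x' | ∃ t : ℝ, zorich (zorich (P + t • !₂[1, x' 0, x' 1])) ∈ V} := by
  obtain ⟨h0, h1, hb⟩ := hx
  have hpi := Real.pi_pos
  obtain ⟨η, hη, hshift⟩ := exists_shift_away_from_sides h0 h1
  refine ⟨min (1 / 25) (ρ / 15000), by positivity, fun ε hε => ?_⟩
  have hdiv : ∀ C : ℝ, Tendsto (fun N : ℝ => C / N) atTop (𝓝 0) := fun C =>
    tendsto_const_nhds.div_atTop tendsto_id
  -- This function is Q/N, hence N/2 ≤ Q ≤ 2N for small τ.
  have hcont : Tendsto (fun τ : ℝ => Real.exp (τ * x 1) * Real.cos τ) (𝓝 0) (𝓝 1) := by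
    have : Continuous (fun τ : ℝ => Real.exp (τ * x 1) * Real.cos τ) := by fun_prop
    simpa using this.tendsto 0
  obtain ⟨d, hd, hratio⟩ := Metric.eventually_nhds_iff.1
    (hcont.eventually (Ioo_mem_nhds (by norm_num : (1 / 2 : ℝ) < 1) (by norm_num : (1 : ℝ) < 2)))
  have hevN : ∀ᶠ N : ℝ in atTop, 64 ≤ N ∧ (2 * |p 2| + 300) / N < η ∧ |p 2| / N < d ∧
      |p 2| / N < 1 / 2 ∧ 300 / N < ε ∧ ∀ y : ℝ, |y| ≤ (|p 2 * x 1| + 44) / N →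
      |N * Real.sin (p 2 / N) * Real.exp y - p 2| < ρ / 3 :=
    (eventually_ge_atTop 64).and <| ((hdiv _).eventually_lt_const hη).and <|
      ((hdiv _).eventually_lt_const hd).and <|
      ((hdiv _).eventually_lt_const (by norm_num)).and <|
      ((hdiv _).eventually_lt_const hε).and <|
      eventually_mul_sin_div_mul_exp_near _ _ (by positivity)
  have ht : Tendsto (fun k : ℕ => (k : ℝ) * Real.pi + Real.pi / 2 - P 0) atTop atTop := by
    have := tendsto_natCast_atTop_atTop (R := ℝ) |>.atTop_mul_const hpi
    simpa [add_sub_assoc] using tendsto_atTop_add_const_right atTop (Real.pi / 2 - P 0) this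
  have hNt : Tendsto (fun k : ℕ => Real.exp (P 2 + ((k : ℝ) * Real.pi + Real.pi / 2 - P 0) * x 1))
      atTop atTop :=
    Real.tendsto_exp_atTop.comp (tendsto_atTop_add_const_left _ _ (ht.atTop_mul_const hb))
  obtain ⟨k₀, hk₀⟩ := eventually_atTop.1 ((hNt.eventually hevN).and (ht.eventually_ge_atTop 2))
  -- Either k₀ or k₀ + 1 gives a crossing at distance at least η from the corners.
  obtain ⟨k, hk, l, hl⟩ : ∃ k, k₀ ≤ k ∧ ∃ l : ℤ,
      |P 1 + ((k : ℝ) * Real.pi + Real.pi / 2 - P 0) * x 0 - l * Real.pi| ≤ Real.pi / 2 - η := by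
    obtain ⟨l, hl | hl⟩ := hshift (P 1 + ((k₀ : ℝ) * Real.pi + Real.pi / 2 - P 0) * x 0)
    · exact ⟨k₀, le_rfl, l, hl⟩
    · refine ⟨k₀ + 1, by omega, l, ?_⟩
      convert hl using 2
      push_cast; ring
  obtain ⟨⟨hN64, hNη, hNd, hN2, hNε, hthird⟩, htk⟩ := hk₀ k hk
  set t := (k : ℝ) * Real.pi + Real.pi / 2 - P 0 with htdef
  set N := Real.exp (P 2 + t * x 1) with hN
  have hN0 : 0 < N := Real.exp_pos _
  set τ : ℝ := -((-1) ^ ((k : ℤ) + l) * (p 2 / N)) with hτ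
  have hτabs : |τ| = |p 2| / N := by
    rw [hτ, abs_neg, abs_neg_one_zpow_mul, abs_div, abs_of_pos hN0]
  have hT : 1 ≤ t + τ := by linarith [neg_abs_le τ]
  have hNdef : N * Real.exp (τ * x 1) = Real.exp (P 2 + (t + τ) * x 1) := by
    rw [hN, ← Real.exp_add]; congr 1; ring
  have hrat := @hratio τ (by rw [Real.dist_eq, sub_zero, hτabs]; exact hNd)
  refine ⟨300 / (N * (t + τ)), by positivity, ?_, ?_⟩
  · refine lt_of_le_of_lt ?_ hNε
    exact div_le_div_of_nonneg_left (by norm_num) hN0 (le_mul_of_one_le_right hN0.le hT)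
  · refine ball_subset_of_crossing hV (k := k) (l := l) (τ := τ)
      (A := Real.pi / 2 - |τ|) (Q := Real.cos τ * Real.exp (P 2 + (t + τ) * x 1))
      (min_le_left _ _) (min_le_right _ _) hT hN64 hτ (by linarith) ?_ hNdef rfl rfl ?_ rfl
      ?_ ?_ hthird
    · rw [htdef]; push_cast; ring
    · have e1 : P 1 + (t + τ) * x 0 - l * Real.pi = (P 1 + t * x 0 - l * Real.pi) + τ * x 0 := by
        ring
      have e2 : |τ * x 0| ≤ |τ| := by
        rw [abs_mul]; exact mul_le_of_le_one_right (abs_nonneg _) h1.le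
      -- One |p₂|/N pays for A = π/2 - |τ|, the other for the drift τ x₀ between the crossing time
      -- and T.
      have e3 : (2 * |p 2| + 300) / N = 2 * (|p 2| / N) + 300 / N := by ring
      rw [e1]
      have := abs_add_le (P 1 + t * x 0 - l * Real.pi) (τ * x 0)
      linarith
    · rw [← hNdef]; nlinarith [hrat.1]
    · rw [← hNdef]; nlinarith [hrat.2]

/-! ### Full measure on each face and conclusion. -/

theorem volume_faceParam_diff_eq_zero (P : E3) (q : E3) {δ : ℝ} (hδ : 0 < δ) :
    volume (faceParam \ {x | ∃ t : ℝ,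
      zorich (zorich (P + t • !₂[1, x 0, x 1])) ∈ Metric.ball q δ}) = 0 := by
  obtain ⟨p, ρ, hρ, hV⟩ := exists_ball_zorich_subset q hδ
  refine addHaar_eq_zero_of_porous volume _ fun x hx => ?_
  obtain ⟨κ, hκ, h⟩ := porous_face P p hρ hV hx.1
  refine ⟨κ, hκ, fun ε hε => ?_⟩
  obtain ⟨r, hr, hrε, y, hy⟩ := h ε hε
  exact ⟨r, hr, hrε, y, fun w hw => ⟨(hy hw).1, fun hw' => hw'.2 (hy hw).2⟩⟩

/-- Since 𝒵 ∘ 𝒵 commutes with the face symmetry, a hit on face i is a hit on the face x₁ = 1 with P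
and q pulled back. -/
theorem faceMap_mem_hitSet {P q : E3} {δ : ℝ} {i : Fin 4} {x : EuclideanSpace ℝ (Fin 2)}
    (hx : x ∈ faceParam) {t : ℝ}
    (ht : zorich (zorich ((faceSymm i).symm P + t • !₂[1, x 0, x 1])) ∈
      Metric.ball ((faceSymm i).symm q) δ) :
    faceMap P (faceSymm i) x ∈ hitSet P (Metric.ball q δ) := by
  refine ⟨?_, _, ⟨AffineMap.lineMap P (faceMap P (faceSymm i) x) t,
    AffineMap.lineMap_mem_affineSpan_pair _ _ _, rfl⟩, ?_⟩
  · rw [lineParam_eq_iUnion]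
    exact mem_iUnion.2 ⟨i, x, hx, rfl⟩
  · have h : AffineMap.lineMap P (faceMap P (faceSymm i) x) t =
        faceSymm i ((faceSymm i).symm P + t • !₂[1, x 0, x 1]) := by
      rw [map_add, LinearIsometryEquiv.apply_symm_apply, map_smul, AffineMap.lineMap_apply, faceMap]
      simp [add_comm]
    rw [Function.comp_apply, h, zorich_faceSymm, zorich_faceSymm, Metric.mem_ball]
    rw [Metric.mem_ball, ← (faceSymm i).dist_map, LinearIsometryEquiv.apply_symm_apply] at ht
    exact ht

theorem theorem2 (P : E3) (q : E3) (δ : ℝ) (hq : ‖q‖ ≠ 1) (hδ : 0 < δ) (hδq : δ < ‖q‖) :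
    ∃ ε : ℝ, 0 < ε ∧
      ∀ α ∈ lineParam P, IsDensityPoint (areaOn P) ε (hitSet P (Metric.ball q δ)) α := by
  refine ⟨1, one_pos, fun α hα => isDensityPoint_one_of_conull (fun i => ?_) hα⟩
  refine measure_mono_null ?_ (volume_faceParam_diff_eq_zero ((faceSymm i).symm P)
    ((faceSymm i).symm q) hδ)
  exact fun x hx => ⟨hx.1, fun ⟨t, ht⟩ => hx.2 (faceMap_mem_hitSet hx.1 ht)⟩
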